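/- All systems are finite-dimensional. A bipartite LOCC protocol from $\mathbb{C}^a\otimes\mathbb{C}^b$ to $\mathbb{C}^x\otimes\mathbb{C}^y$ is a finite tree of rounds. In each round one party (Alice on the first factor, Bob on the second) applies a local quantum instrument, given by Kraus operators $K_{o,i}$ with $\sum_{o,i}K_{o,i}^\dagger K_{o,i}=1$, whose announced outcome $o\in\{0,1\}^m$ is sent to the other party. Here $m=0$ is allowed (a local operation without communication), the dimension of the output system is arbitrary (so that ancillas can be added or discarded and unannounced results kept as local registers), and everything that follows, including who acts next, may depend on the messages sent so far. The cost of the protocol is the maximum, over all sequences of messages, of the total number of bits sent in both directions. For a given input state, the output distribution assigns to each transcript $t$ (complete sequence of messages) the unnormalised output state $\sigma_t$ on $\mathbb{C}^x\otimes\mathbb{C}^y$; $\operatorname{Tr}\sigma_t$ is the probability of $t$, and $\sigma_t/\operatorname{Tr}\sigma_t$ is the final state given $t$. **Claim.** Let $|\psi\rangle\in\mathbb{C}^a\otimes\mathbb{C}^b$ be a unit vector, and let $P$ be an LOCC protocol from $\mathbb{C}^a\otimes\mathbb{C}^b$ to $\mathbb{C}^x\otimes\mathbb{C}^y$ of cost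 at most $c$. Then there is an LOCC protocol $S$ of cost $c$, with the same input and output systems, of the following form: 1. Alice performs on her half of the input a generalized measurement $\{M_k\}_{k\in\{0,1\}^c}$ with operators $M_k:\mathbb{C}^a\to\mathbb{C}^x\otimes\mathcal{A}'$, $\sum_k M_k^\dagger M_k=1$ (hence with at most $2^c$ outcomes); 2. she sends the whole outcome $k$ to Bob, using $c$ bits; 3. Bob adds an ancilla $\mathcal{B}_0$ in a fixed pure state and applies a unitary $U_k:\mathbb{C}^b\otimes\mathcal{B}_0\to\mathbb{C}^y\otimes\mathcal{B}'$ depending on $k$; 4. Alice and Bob discard $\mathcal{A}'$ and $\mathcal{B}'$, respectively. On the input $|\psi\rangle\langle\psi|$, $S$ has the same output distribution as $P$: there is an injective map $e$ from the transcripts of $P$ to those of $S$ such that for every transcript $t$ of $P$ the unnormalised output state of $S$ at $e(t)$ equals that of $P$ at $t$, while every transcript of $S$ outside the image of $e$ has unnormalised output state $0$ (it occurs with probability $0$). -/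

import Mathlib

open scoped Matrix Kronecker

noncomputable section

namespace LOCC

/-- Messages of `m` classical bits. -/
abbrev Msg (m : ℕ) : Type := Fin m → Bool

/-- A local operation (quantum instrument) on a `d`-dimensional system whose classical outcome `o`
is a string of `m` bits, in Kraus form.  Upon outcome `o` the system is left in a system of
dimension `d' o`, and the (unnormalised) state is transformed by the completely positive map with
Kraus operators `K o i`.  The case `m = 0` is a local quantum channel.  Measurement results that
are not announced are recorded in the (arbitrary) output system of the operation. -/
structure LocalOp (m d : ℕ) (d' : Msg m → ℕ) where
  rk : Msg m → ℕ
  K : (o : Msg m) → Fin (rk o) → Matrix (Fin (d' o)) (Fin d) ℂ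
  complete : ∑ o, ∑ i, (K o i)ᴴ * K o i = 1

/-- The action of outcome `o` of a local operation of Alice on a bipartite state. -/
def LocalOp.onAlice {m a b : ℕ} {a' : Msg m → ℕ} (L : LocalOp m a a') (o : Msg m)
    (ρ : Matrix (Fin a × Fin b) (Fin a × Fin b) ℂ) :
    Matrix (Fin (a' o) × Fin b) (Fin (a' o) × Fin b) ℂ :=
  ∑ i, (L.K o i ⊗ₖ (1 : Matrix (Fin b) (Fin b) ℂ)) * ρ *
    (L.K o i ⊗ₖ (1 : Matrix (Fin b) (Fin b) ℂ))ᴴ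

/-- The action of outcome `o` of a local operation of Bob on a bipartite state. -/
def LocalOp.onBob {m a b : ℕ} {b' : Msg m → ℕ} (L : LocalOp m b b') (o : Msg m)
    (ρ : Matrix (Fin a × Fin b) (Fin a × Fin b) ℂ) :
    Matrix (Fin a × Fin (b' o)) (Fin a × Fin (b' o)) ℂ :=
  ∑ i, ((1 : Matrix (Fin a) (Fin a) ℂ) ⊗ₖ L.K o i) * ρ *
    ((1 : Matrix (Fin a) (Fin a) ℂ) ⊗ₖ L.K o i)ᴴ

/-- LOCC protocols taking a bipartite `a × b` system to a bipartite `x × y` system.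
In each round one party performs a local operation and sends its `m`-bit outcome to the
other party (`m = 0` is a local operation without communication).  Everything that happens
afterwards, including who acts next, may depend on the messages sent so far. -/
inductive Protocol (x y : ℕ) : ℕ → ℕ → Type
  | done : Protocol x y x y
  | alice {a b m : ℕ} {a' : Msg m → ℕ} (L : LocalOp m a a')
      (next : (o : Msg m) → Protocol x y (a' o) b) : Protocol x y a b
  | bob {a b m : ℕ} {b' : Msg m → ℕ} (L : LocalOp m b b')
      (next : (o : Msg m) → Protocol x y a (b' o)) : Protocol x y a b

namespace Protocol

/-- Total number of bits of classical communication, in both directions, in the worst case. -/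
def cost {x y : ℕ} : {a b : ℕ} → Protocol x y a b → ℕ
  | _, _, done => 0
  | _, _, alice (m := m) _ next => m + Finset.univ.sup fun o => (next o).cost
  | _, _, bob (m := m) _ next => m + Finset.univ.sup fun o => (next o).cost

/-- The complete records of the messages sent in a run of the protocol. -/
def Transcript {x y : ℕ} : {a b : ℕ} → Protocol x y a b → Type
  | _, _, done => Unit
  | _, _, alice (m := m) _ next => Σ o : Msg m, (next o).Transcript
  | _, _, bob (m := m) _ next => Σ o : Msg m, (next o).Transcript

/-- The unnormalised output state of the protocol for a given transcript, on input `ρ`: its trace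
is the probability of the transcript, and, if this is not zero, dividing by the trace gives the
final state conditioned on the transcript. -/
def output {x y : ℕ} : {a b : ℕ} → (P : Protocol x y a b) →
    Matrix (Fin a × Fin b) (Fin a × Fin b) ℂ → P.Transcript →
    Matrix (Fin x × Fin y) (Fin x × Fin y) ℂ
  | _, _, done => fun ρ _ => ρ
  | _, _, alice (m := m) L next => fun ρ (t : Σ o : Msg m, (next o).Transcript) =>
      (next t.1).output (L.onAlice t.1 ρ) t.2
  | _, _, bob (m := m) L next => fun ρ (t : Σ o : Msg m, (next o).Transcript) =>
      (next t.1).output (L.onBob t.1 ρ) t.2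

end Protocol

/-- The embedding `v ↦ v ⊗ |i⟩` of a `d`-dimensional system into its tensor product with an
`n`-dimensional one; `Fin (d * n)` indexes the product basis through `finProdFinEquiv`. -/
def tensorBasis (d : ℕ) {n : ℕ} (i : Fin n) : Matrix (Fin (d * n)) (Fin d) ℂ :=
  Matrix.of fun t s => if t = finProdFinEquiv (s, i) then 1 else 0

theorem tensorBasis_isometry (d : ℕ) {n : ℕ} (i : Fin n) :
    (tensorBasis d i)ᴴ * tensorBasis d i = 1 := by
  ext s s'
  simp [Matrix.mul_apply, tensorBasis, Matrix.one_apply, eq_comm]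

theorem tensorBasis_complete (d n : ℕ) :
    ∑ i : Fin n, tensorBasis d i * (tensorBasis d i)ᴴ = 1 := by
  ext t t'
  obtain ⟨⟨s, j⟩, rfl⟩ := finProdFinEquiv.surjective t
  obtain ⟨⟨s', j'⟩, rfl⟩ := finProdFinEquiv.surjective t'
  simp only [Matrix.sum_apply, Matrix.mul_apply, tensorBasis, Matrix.conjTranspose_apply,
    Matrix.of_apply, EmbeddingLike.apply_eq_iff_eq, Prod.mk.injEq, Matrix.one_apply]
  rw [Finset.sum_eq_single j (by intro i _ hi; simp [Ne.symm hi]) (by simp),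
    Finset.sum_eq_single s (by intro i _ hi; simp [Ne.symm hi]) (by simp)]
  by_cases h : s = s' <;> by_cases h' : j = j' <;> simp [h, h', eq_comm]

namespace LocalOp

/-- A generalised measurement with operators `M k`, `∑ k, (M k)ᴴ * M k = 1`; its outcome is `k`. -/
def measurement {m d d' : ℕ} (M : Msg m → Matrix (Fin d') (Fin d) ℂ)
    (hM : ∑ k, (M k)ᴴ * M k = 1) : LocalOp m d (fun _ => d') where
  rk _ := 1
  K k _ := M k
  complete := by simpa using hM

/-- An isometry, applied without communication. -/
def isometry {d d' : ℕ} (V : Matrix (Fin d') (Fin d) ℂ) (hV : Vᴴ * V = 1) :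
    LocalOp 0 d (fun _ => d') where
  rk _ := 1
  K _ _ := V
  complete := by simpa using hV

/-- Adding an ancilla of dimension `n` prepared in the basis state `|i⟩`. -/
def addAncilla (d : ℕ) {n : ℕ} (i : Fin n) : LocalOp 0 d (fun _ => d * n) :=
  isometry (tensorBasis d i) (tensorBasis_isometry d i)

/-- Discarding (tracing out) an ancilla of dimension `n`. -/
def discard (d n : ℕ) : LocalOp 0 (d * n) (fun _ => d) where
  rk _ := n
  K _ i := (tensorBasis d i)ᴴ
  complete := by simpa using tensorBasis_complete d n

end LocalOp

/-- The data of a protocol in standard form with `c` bits of communication. -/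
structure StandardForm (x y a b c : ℕ) where
  /-- dimension of the ancilla that Alice discards in the end -/
  aliceAnc : ℕ
  /-- dimension of the ancilla that Bob discards in the end -/
  bobAnc : ℕ
  /-- dimension of the ancilla that Bob adds -/
  bobInit : ℕ
  /-- the basis state in which Bob prepares it -/
  init : Fin bobInit
  /-- Alice's generalised measurement on her half of the input, with outcomes in `Msg c` -/
  M : Msg c → Matrix (Fin (x * aliceAnc)) (Fin a) ℂ
  M_complete : ∑ k, (M k)ᴴ * M k = 1
  /-- Bob's unitary operations; input and output space are the same space, factorised once as
  (input system) ⊗ (added ancilla) and once as (output system) ⊗ (discarded ancilla) -/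
  U : Msg c → Matrix (Fin (y * bobAnc)) (Fin (b * bobInit)) ℂ
  U_left : ∀ k, (U k)ᴴ * U k = 1
  U_right : ∀ k, U k * (U k)ᴴ = 1

/-- Alice measures `{M k}` and sends the whole outcome `k` to Bob; Bob adds his ancilla and applies
the unitary `U k`; both discard their ancillas. -/
def StandardForm.toProtocol {x y a b c : ℕ} (S : StandardForm x y a b c) : Protocol x y a b :=
  .alice (LocalOp.measurement S.M S.M_complete) fun k =>
  .bob (LocalOp.addAncilla b S.init) fun _ =>
  .bob (LocalOp.isometry (S.U k) (S.U_left k)) fun _ =>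
  .alice (LocalOp.discard x S.aliceAnc) fun _ =>
  .bob (LocalOp.discard y S.bobAnc) fun _ =>
  .done

/-- The density matrix `|ψ⟩⟨ψ|`. -/
def pureState {a b : ℕ} (ψ : Fin a × Fin b → ℂ) : Matrix (Fin a × Fin b) (Fin a × Fin b) ℂ :=
  Matrix.vecMulVec ψ (star ψ)

end LOCC

end

open scoped Matrix Kronecker

noncomputable section

namespace LOCC

open scoped ComplexOrder

/-! This is the Lo–Popescu argument. On coefficient matrices Alice's operator `A` acts as `A * Ψ`
and Bob's `B` as `Ψ * Bᵀ`. In Schmidt bases the state is symmetric between the parties, so if Alice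
performs Bob's measurement in his stead she reaches the transpose of the state he would have
produced. A matrix and its transpose have the same singular values, so local corrections depending
on the outcome repair this (`exists_swap_measurement`).

Unannounced Kraus indices are kept in ancillas (`stack`), so every branch stays pure until `reduced`
traces the ancillas out. Induction on the protocol tree then moves all measuring to Alice and leaves
Bob one operator per transcript (`Protocol.exists_submeasurement`). By `Protocol.card_transcript_le`
the transcripts fit into `Msg c`.

The corrections are only partial isometries, so this yields submeasurements and contractions. Since
`P` itself loses no probability, the operators completing them annihilate the state
(`exists_completion`) and can be added without changing any output (`exists_standardForm`). Bob's
resulting isometries extend to unitaries on a larger space. -/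

/-! ### Contractions and submeasurements -/

/-- A matrix with `1 - Aᴴ * A` positive semidefinite, i.e. of operator norm at most one. -/
def IsContraction {m n : Type*} [Fintype m] [DecidableEq n] (A : Matrix m n ℂ) : Prop :=
  (1 - Aᴴ * A).PosSemidef

/-- A family of operators that can be completed to a generalised measurement. -/
def IsSubmeasurement {ι n : Type*} {κ : ι → Type*} [Fintype ι] [∀ i, Fintype (κ i)]
    [DecidableEq n] (A : ∀ i, Matrix (κ i) n ℂ) : Prop :=
  (1 - ∑ i, (A i)ᴴ * A i).PosSemidef

theorem IsSubmeasurement.mul_right {ι m n : Type*} {κ : ι → Type*} [Fintype ι]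
    [∀ i, Fintype (κ i)] [Fintype m] [DecidableEq m] [Fintype n] [DecidableEq n]
    {A : ∀ i, Matrix (κ i) m ℂ} {C : Matrix m n ℂ} (hA : IsSubmeasurement A)
    (hC : IsContraction C) : IsSubmeasurement fun i => A i * C := by
  have h := (hA.conjTranspose_mul_mul_same C).add hC
  unfold IsSubmeasurement
  convert h using 1
  simp only [Matrix.conjTranspose_mul, Matrix.mul_sub, Matrix.sub_mul, Matrix.mul_one,
    Matrix.mul_sum, Matrix.sum_mul, Matrix.mul_assoc]
  abel

/-- Measuring adaptively in two rounds: the total defect is the defect of `A` plus the defects of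
the `C i` pulled back along `A i`. -/
theorem IsSubmeasurement.sigma {ι n : Type*} {κ : ι → Type*} {ν : ι → Type*}
    {μ : ∀ i, ν i → Type*} [Fintype ι] [∀ i, Fintype (κ i)] [∀ i, DecidableEq (κ i)]
    [∀ i, Fintype (ν i)] [∀ i j, Fintype (μ i j)] [Fintype n] [DecidableEq n]
    {A : ∀ i, Matrix (κ i) n ℂ} {C : ∀ i j, Matrix (μ i j) (κ i) ℂ} (hA : IsSubmeasurement A)
    (hC : ∀ i, IsSubmeasurement (C i)) :
    (1 - ∑ i, ∑ j, (C i j * A i)ᴴ * (C i j * A i)).PosSemidef := by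
  have h := hA.add (Matrix.posSemidef_sum Finset.univ
    fun i _ => (hC i).conjTranspose_mul_mul_same (A i))
  convert h using 1
  simp only [Matrix.conjTranspose_mul, Matrix.mul_sub, Matrix.sub_mul, Matrix.mul_one,
    Matrix.mul_sum, Matrix.sum_mul, Matrix.mul_assoc, Finset.sum_sub_distrib]
  abel

theorem IsContraction.mul {l m n : Type*} [Fintype l] [Fintype m] [DecidableEq m] [Fintype n]
    [DecidableEq n] {A : Matrix l m ℂ} {C : Matrix m n ℂ} (hA : IsContraction A)
    (hC : IsContraction C) : IsContraction (A * C) := by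
  have h := (hA.conjTranspose_mul_mul_same C).add hC
  unfold IsContraction
  convert h using 1
  simp only [Matrix.conjTranspose_mul, Matrix.mul_sub, Matrix.sub_mul, Matrix.mul_one,
    Matrix.mul_assoc]
  abel

theorem isContraction_of_conjTranspose_mul_self {m n : Type*} [Fintype m] [DecidableEq n]
    {A : Matrix m n ℂ} (h : Aᴴ * A = 1) : IsContraction A := by
  simp [IsContraction, h, Matrix.PosSemidef.zero]

theorem isContraction_transpose {m n : Type*} [Fintype n] [DecidableEq m]
    {A : Matrix m n ℂ} (h : A * Aᴴ = 1) : IsContraction Aᵀ :=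
  isContraction_of_conjTranspose_mul_self <| by
    have := congrArg Matrix.transpose h
    rwa [Matrix.transpose_mul, Matrix.transpose_one] at this

/-- The defect `1 - Pᴴ * P` is a projection, hence of the form `Xᴴ * X`. -/
theorem isContraction_of_partialIsometry {m n : Type*} [Fintype m] [Fintype n] [DecidableEq n]
    {P : Matrix m n ℂ} (h : P * Pᴴ * P = P) : IsContraction P := by
  have e : (1 - Pᴴ * P)ᴴ * (1 - Pᴴ * P) = 1 - Pᴴ * P := by
    have : Pᴴ * P * (Pᴴ * P) = Pᴴ * P := by
      rw [Matrix.mul_assoc, ← Matrix.mul_assoc P, h]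
    simp [Matrix.sub_mul, Matrix.mul_sub, this]
  unfold IsContraction
  rw [← e]
  exact Matrix.posSemidef_conjTranspose_mul_self _

theorem partialIsometry_conjTranspose {m n : Type*} [Fintype m] [Fintype n]
    {P : Matrix m n ℂ} (h : P * Pᴴ * P = P) : Pᴴ * Pᴴᴴ * Pᴴ = Pᴴ := by
  conv_rhs => rw [← h]
  simp [Matrix.mul_assoc]

/-! ### Singular values and the exchange of measurements -/

/-- A form of the singular value decomposition. -/
theorem exists_svd {m n : Type*} [Fintype m] [DecidableEq m] [Fintype n] [DecidableEq n]
    (A : Matrix m n ℂ) : ∃ (P : Matrix m n ℂ) (d : n → ℂ) (Q : Matrix n n ℂ),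
      A = P * Matrix.diagonal d * Q ∧ P * Pᴴ * P = P ∧
      Pᴴ * P * Matrix.diagonal d = Matrix.diagonal d ∧ Qᴴ * Q = 1 ∧ Q * Qᴴ = 1 := by
  have hpsd := Matrix.posSemidef_conjTranspose_mul_self A
  set hA := hpsd.isHermitian
  set W : Matrix n n ℂ := hA.eigenvectorUnitary.1
  set ev := hA.eigenvalues
  have hev : ∀ i, 0 ≤ ev i := hpsd.eigenvalues_nonneg
  have hW1 : Wᴴ * W = 1 := Unitary.coe_star_mul_self hA.eigenvectorUnitary
  have hW2 : W * Wᴴ = 1 := Unitary.coe_mul_star_self hA.eigenvectorUnitary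
  have hspec : Aᴴ * A = W * Matrix.diagonal (fun i => (ev i : ℂ)) * Wᴴ := by
    have := hA.spectral_theorem
    rwa [Unitary.conjStarAlgAut_apply] at this
  have hgram : (A * W)ᴴ * (A * W) = Matrix.diagonal (fun i => (ev i : ℂ)) := by
    rw [Matrix.conjTranspose_mul, Matrix.mul_assoc, ← Matrix.mul_assoc Aᴴ, hspec]
    calc Wᴴ * (W * Matrix.diagonal (fun i => (ev i : ℂ)) * Wᴴ * W)
        = (Wᴴ * W) * Matrix.diagonal (fun i => (ev i : ℂ)) * (Wᴴ * W) := by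
          simp only [Matrix.mul_assoc]
      _ = _ := by simp [hW1]
  set s : n → ℂ := fun i => (Real.sqrt (ev i) : ℂ) with hs
  have hss : ∀ i, s i * s i = ev i := fun i => by
    rw [hs]; dsimp only; rw [← Complex.ofReal_mul, Real.mul_self_sqrt (hev i)]
  have hstar : ∀ i, star (s i) = s i := fun i => by simp [hs]
  -- With `0⁻¹ = 0` the columns for zero singular values become zero, so `P` is a partial isometry
  -- and no condition relating `m` and `n` is needed.
  set P := A * W * Matrix.diagonal (fun i => (s i)⁻¹) with hP
  have hPP : Pᴴ * P = Matrix.diagonal (fun i => (s i)⁻¹ * s i) := by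
    rw [hP, Matrix.conjTranspose_mul, Matrix.mul_assoc, ← Matrix.mul_assoc (A * W)ᴴ, hgram,
      Matrix.diagonal_conjTranspose, Matrix.diagonal_mul_diagonal, Matrix.diagonal_mul_diagonal]
    congr 1; ext i
    simp only [Pi.star_apply, star_inv₀, hstar, ← hss]
    by_cases h : s i = 0
    · simp [h]
    · field_simp
  -- The discarded columns of `A * W` already vanish, because their Gram matrix does.
  have hzero : A * W * Matrix.diagonal (fun i => 1 - (s i)⁻¹ * s i) = 0 := by
    rw [← Matrix.conjTranspose_mul_self_eq_zero, Matrix.conjTranspose_mul, Matrix.mul_assoc,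
      ← Matrix.mul_assoc (A * W)ᴴ, hgram, Matrix.diagonal_mul_diagonal,
      Matrix.diagonal_conjTranspose, Matrix.diagonal_mul_diagonal, ← Matrix.diagonal_zero]
    congr 1; ext i
    by_cases h : s i = 0
    · simp [← hss, h]
    · simp [h]
  refine ⟨P, s, Wᴴ, ?_, ?_, ?_, by simpa using hW2, by simpa using hW1⟩
  · have h1 : A * W * Matrix.diagonal (fun i => (s i)⁻¹ * s i) = A * W := by
      rw [← sub_eq_zero, ← neg_eq_zero, ← hzero, ← Matrix.diagonal_sub, Matrix.diagonal_one,
        Matrix.mul_sub, Matrix.mul_one]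
      abel
    rw [hP, Matrix.mul_assoc (A * W), Matrix.diagonal_mul_diagonal, h1, Matrix.mul_assoc, hW2,
      Matrix.mul_one]
  · rw [Matrix.mul_assoc, hPP, hP, Matrix.mul_assoc (A * W), Matrix.diagonal_mul_diagonal]
    congr 2; ext i
    by_cases h : s i = 0 <;> simp [h]
  · rw [hPP, Matrix.diagonal_mul_diagonal]
    congr 1; ext i
    by_cases h : s i = 0 <;> simp [h]

/-- From `A = P d Q` one gets `Aᵀ = Qᵀ d Pᵀ = (Qᵀ Pᴴ) A (Qᴴ Pᵀ)`. The bound concerns `Vᵀ` because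
Bob's operators enter coefficient matrices transposed. -/
theorem exists_transpose_eq_mul_mul {m n : Type*} [Fintype m] [DecidableEq m] [Fintype n]
    [DecidableEq n] (A : Matrix m n ℂ) : ∃ (U : Matrix n m ℂ) (V : Matrix n m ℂ),
      IsContraction U ∧ IsContraction Vᵀ ∧ Aᵀ = U * A * V := by
  obtain ⟨P, d, Q, rfl, hP, hPd, hQ, hQ'⟩ := exists_svd A
  have hQt := isContraction_transpose hQ'
  have hQc := isContraction_transpose (A := Qᴴ) (by simpa using hQ)
  refine ⟨Qᵀ * Pᴴ, Qᴴ * Pᵀ, hQt.mul (isContraction_of_partialIsometry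
    (partialIsometry_conjTranspose hP)), ?_, ?_⟩
  · rw [Matrix.transpose_mul, Matrix.transpose_transpose]
    exact (isContraction_of_partialIsometry hP).mul hQc
  · calc (P * Matrix.diagonal d * Q)ᵀ = Qᵀ * (Pᴴ * P * Matrix.diagonal d) * Pᵀ := by
          rw [hPd]; simp [Matrix.mul_assoc]
      _ = Qᵀ * (Pᴴ * P * Matrix.diagonal d) * (Q * Qᴴ) * Pᵀ := by rw [hQ', Matrix.mul_one]
      _ = _ := by simp only [Matrix.mul_assoc]

/-- On a fixed pure state, with coefficient matrix `Ψ`, a measurement by one party has the same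
effect as a measurement by the other party followed by an operation of the first one. -/
theorem exists_swap_measurement {ι m n : Type*} {κ : ι → Type*} [Fintype ι]
    [∀ i, Fintype (κ i)] [∀ i, DecidableEq (κ i)] [Fintype m] [DecidableEq m] [Fintype n]
    [DecidableEq n] (Ψ : Matrix m n ℂ) {B : ∀ i, Matrix (κ i) n ℂ} (hB : IsSubmeasurement B) :
    ∃ (N : ι → Matrix m m ℂ) (V : ∀ i, Matrix (κ i) n ℂ), IsSubmeasurement N ∧
      (∀ i, IsContraction (V i)) ∧ ∀ i, Ψ * (B i)ᵀ = N i * Ψ * (V i)ᵀ := by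
  obtain ⟨P, d, Q, hΨ, hP, hPd, hQ, hQ'⟩ := exists_svd Ψ
  have hPc := isContraction_of_partialIsometry hP
  have hQt := isContraction_transpose hQ'
  have hQc := isContraction_transpose (A := Qᴴ) (by simpa using hQ)
  -- `B i * Qᵀ * diagonal d` is the state, in Schmidt bases, after Alice has applied Bob's operator;
  -- its transpose is what Bob's own measurement gives.
  choose U V hU hV hUV using fun i =>
    exists_transpose_eq_mul_mul (B i * Qᵀ * Matrix.diagonal d)
  refine ⟨fun i => P * U i * (B i * (Qᵀ * Pᴴ)), fun i => (V i)ᵀ * Qᴴᵀ, ?_,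
    fun i => (hV i).mul hQc, fun i => ?_⟩
  · have h1 := hB.mul_right (hQt.mul (isContraction_of_partialIsometry
      (partialIsometry_conjTranspose hP)))
    -- A one-point second index turns the two-round lemma into a correction `P * U i` chosen by the
    -- outcome.
    have h2 := h1.sigma (ν := fun _ => Unit) (C := fun i _ => P * U i) fun i => by
      simpa [IsSubmeasurement, IsContraction] using hPc.mul (hU i)
    simpa [IsSubmeasurement] using h2
  · calc Ψ * (B i)ᵀ = P * (B i * Qᵀ * Matrix.diagonal d)ᵀ := by
          simp [hΨ, Matrix.mul_assoc]
      _ = P * (U i * (B i * Qᵀ * (Pᴴ * P * Matrix.diagonal d)) * V i) := by rw [hUV, hPd]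
      _ = P * (U i * (B i * Qᵀ * (Pᴴ * P * Matrix.diagonal d)) * ((Q * Qᴴ) * V i)) := by
          rw [hQ', Matrix.one_mul]
      _ = _ := by simp [hΨ, Matrix.mul_assoc]

/-! ### Purified states and local operations -/

theorem mul_pureState_mul {a b a' b' : ℕ} (A : Matrix (Fin a' × Fin b') (Fin a × Fin b) ℂ)
    (ψ : Fin a × Fin b → ℂ) : A * pureState ψ * Aᴴ = pureState (A *ᵥ ψ) := by
  rw [pureState, pureState, Matrix.mul_vecMulVec, Matrix.vecMulVec_mul, Matrix.star_mulVec]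

/-- The vector with coefficient matrix `Φ`. -/
def coeffVec {a b : Type*} (Φ : Matrix a b ℂ) : a × b → ℂ := fun p => Φ p.1 p.2

/-- The reduced density matrix on `x × y` of the pure state with coefficient matrix `Φ`, where
Alice holds `x × R` and Bob holds `y × R'`. -/
def reduced {x y : ℕ} {R R' : Type*} [Fintype R] [Fintype R']
    (Φ : Matrix (Fin x × R) (Fin y × R') ℂ) : Matrix (Fin x × Fin y) (Fin x × Fin y) ℂ :=
  ∑ r, ∑ r', pureState (coeffVec (Φ.submatrix (·, r) (·, r')))

theorem trace_reduced {x y : ℕ} {R R' : Type*} [Fintype R] [Fintype R']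
    (Φ : Matrix (Fin x × R) (Fin y × R') ℂ) : (reduced Φ).trace = (Φᴴ * Φ).trace := by
  have h : (Φᴴ * Φ).trace = ∑ q, ∑ p, Φ p q * star (Φ p q) := by
    simp [Matrix.trace, Matrix.mul_apply, mul_comm]
  rw [h, Finset.sum_comm, Fintype.sum_prod_type, Finset.sum_comm]
  simp only [reduced, Matrix.trace_sum, pureState, Matrix.trace_vecMulVec, dotProduct,
    Fintype.sum_prod_type, Pi.star_apply, coeffVec, Matrix.submatrix_apply]
  refine Finset.sum_congr rfl fun r _ => ?_
  rw [Finset.sum_comm]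
  refine Finset.sum_congr rfl fun s _ => ?_
  rw [Finset.sum_comm]

/-- A family of operators, with its index and a spectator system of dimension `r` stored in an
ancilla. -/
def stack {d d' n : ℕ} (K : Fin n → Matrix (Fin d') (Fin d) ℂ) (r : ℕ) :
    Matrix (Fin d' × Fin (n * r)) (Fin d × Fin r) ℂ :=
  Matrix.of fun p q =>
    if (finProdFinEquiv.symm p.2).2 = q.2 then K (finProdFinEquiv.symm p.2).1 p.1 q.1 else 0

theorem stack_apply {d d' n r : ℕ} (K : Fin n → Matrix (Fin d') (Fin d) ℂ) (s : Fin d')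
    (i : Fin n) (j : Fin r) (q : Fin d × Fin r) :
    stack K r (s, finProdFinEquiv (i, j)) q = if j = q.2 then K i s q.1 else 0 := by
  rw [stack, Matrix.of_apply, Equiv.symm_apply_apply]

theorem stack_conjTranspose_mul_self {d d' n : ℕ} (K : Fin n → Matrix (Fin d') (Fin d) ℂ) (r : ℕ) :
    (stack K r)ᴴ * stack K r = (∑ i, (K i)ᴴ * K i) ⊗ₖ (1 : Matrix (Fin r) (Fin r) ℂ) := by
  ext ⟨s, j⟩ ⟨s', j'⟩
  simp only [Matrix.mul_apply, Matrix.conjTranspose_apply,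
    Fintype.sum_prod_type, Matrix.kroneckerMap_apply, Matrix.sum_apply, Matrix.one_apply]
  rw [Finset.sum_comm, ← finProdFinEquiv.sum_comp, Fintype.sum_prod_type, Finset.sum_mul]
  refine Finset.sum_congr rfl fun i _ => ?_
  rw [Finset.sum_eq_single j (by intro k _ hk; simp [stack_apply, hk]) (by simp)]
  by_cases h : j = j' <;> simp [stack_apply, h]

theorem LocalOp.isSubmeasurement_stack {m d : ℕ} {d' : Msg m → ℕ} (L : LocalOp m d d') (r : ℕ) :
    IsSubmeasurement fun o => stack (L.K o) r := by
  have h : ∑ o, (stack (L.K o) r)ᴴ * stack (L.K o) r = 1 := by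
    simp_rw [stack_conjTranspose_mul_self]
    ext ⟨s, j⟩ ⟨s', j'⟩
    have := congrFun (congrFun L.complete s) s'
    simp only [Matrix.sum_apply, Matrix.kroneckerMap_apply, ← Finset.sum_mul] at this ⊢
    rw [this, ← Matrix.one_kronecker_one]
    rfl
  simp [IsSubmeasurement, h, Matrix.PosSemidef.zero]

theorem stack_mul_apply {d d' n r : ℕ} {N : Type*} (K : Fin n → Matrix (Fin d') (Fin d) ℂ)
    (Φ : Matrix (Fin d × Fin r) N ℂ) (s : Fin d') (i : Fin n) (j : Fin r) (q : N) :
    (stack K r * Φ) (s, finProdFinEquiv (i, j)) q = ∑ u, K i s u * Φ (u, j) q := by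
  simp [Matrix.mul_apply, stack_apply, Fintype.sum_prod_type]

theorem kronecker_one_mulVec {a b a' : ℕ} (A : Matrix (Fin a') (Fin a) ℂ)
    (Φ : Matrix (Fin a) (Fin b) ℂ) :
    (A ⊗ₖ (1 : Matrix (Fin b) (Fin b) ℂ)) *ᵥ coeffVec Φ = coeffVec (A * Φ) := by
  ext p
  simp [Matrix.mulVec, dotProduct, Fintype.sum_prod_type, Matrix.one_apply, coeffVec,
    Matrix.mul_apply]

theorem one_kronecker_mulVec {a b b' : ℕ} (B : Matrix (Fin b') (Fin b) ℂ)
    (Φ : Matrix (Fin a) (Fin b) ℂ) :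
    ((1 : Matrix (Fin a) (Fin a) ℂ) ⊗ₖ B) *ᵥ coeffVec Φ = coeffVec (Φ * Bᵀ) := by
  ext p
  simp [Matrix.mulVec, dotProduct, Fintype.sum_prod_type, Matrix.one_apply, coeffVec,
    Matrix.mul_apply, mul_comm]

/-- Stinespring dilation: summing over the unannounced index `i` is the same as storing it in
Alice's ancilla and tracing that out, so one operator on a pure state suffices. -/
theorem LocalOp.onAlice_reduced {m a b r r' : ℕ} {a' : Msg m → ℕ} (L : LocalOp m a a')
    (o : Msg m) (Φ : Matrix (Fin a × Fin r) (Fin b × Fin r') ℂ) :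
    L.onAlice o (reduced Φ) = reduced (stack (L.K o) r * Φ) := by
  simp only [LocalOp.onAlice, reduced, Matrix.mul_sum, Matrix.sum_mul, mul_pureState_mul]
  rw [← finProdFinEquiv.sum_comp, Fintype.sum_prod_type]
  refine Finset.sum_congr rfl fun i _ => Finset.sum_congr rfl fun j _ =>
    Finset.sum_congr rfl fun j' _ => congrArg pureState (funext fun p => ?_)
  rw [kronecker_one_mulVec]
  simp only [coeffVec, Matrix.submatrix_apply, stack_mul_apply]
  simp [Matrix.mul_apply]

theorem LocalOp.onBob_reduced {m a b r r' : ℕ} {b' : Msg m → ℕ} (L : LocalOp m b b')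
    (o : Msg m) (Φ : Matrix (Fin a × Fin r) (Fin b × Fin r') ℂ) :
    L.onBob o (reduced Φ) = reduced (Φ * (stack (L.K o) r')ᵀ) := by
  simp only [LocalOp.onBob, reduced, Matrix.mul_sum, Matrix.sum_mul, mul_pureState_mul]
  rw [Finset.sum_comm]
  refine Finset.sum_congr rfl fun j _ => ?_
  rw [← finProdFinEquiv.sum_comp, Fintype.sum_prod_type]
  refine Finset.sum_congr rfl fun i _ =>
    Finset.sum_congr rfl fun j' _ => congrArg pureState (funext fun p => ?_)
  rw [one_kronecker_mulVec]
  simp only [coeffVec, Matrix.submatrix_apply]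
  rw [← Matrix.transpose_apply (Φ * _), Matrix.transpose_mul, Matrix.transpose_transpose,
    stack_mul_apply]
  simp [Matrix.mul_apply, mul_comm]

theorem LocalOp.sum_trace_onAlice {m a b : ℕ} {a' : Msg m → ℕ} (L : LocalOp m a a')
    (ρ : Matrix (Fin a × Fin b) (Fin a × Fin b) ℂ) :
    ∑ o, (L.onAlice o ρ).trace = ρ.trace := by
  have h : ∀ o i, ((L.K o i ⊗ₖ (1 : Matrix (Fin b) (Fin b) ℂ)) * ρ *
      (L.K o i ⊗ₖ (1 : Matrix (Fin b) (Fin b) ℂ))ᴴ).trace =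
      ((((L.K o i)ᴴ * L.K o i) ⊗ₖ (1 : Matrix (Fin b) (Fin b) ℂ)) * ρ).trace := fun o i => by
    rw [Matrix.trace_mul_comm, ← Matrix.mul_assoc, Matrix.conjTranspose_kronecker,
      Matrix.conjTranspose_one, ← Matrix.mul_kronecker_mul, Matrix.one_mul]
  have hs : ∑ o, ∑ i, ((L.K o i)ᴴ * L.K o i) ⊗ₖ (1 : Matrix (Fin b) (Fin b) ℂ) = 1 := by
    rw [← Matrix.one_kronecker_one, ← L.complete]
    ext p q
    simp [Matrix.sum_apply, Finset.sum_mul]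
  simp only [LocalOp.onAlice, Matrix.trace_sum, h]
  simp only [← Matrix.trace_sum, ← Matrix.sum_mul, hs, Matrix.one_mul]

theorem LocalOp.sum_trace_onBob {m a b : ℕ} {b' : Msg m → ℕ} (L : LocalOp m b b')
    (ρ : Matrix (Fin a × Fin b) (Fin a × Fin b) ℂ) :
    ∑ o, (L.onBob o ρ).trace = ρ.trace := by
  have h : ∀ o i, (((1 : Matrix (Fin a) (Fin a) ℂ) ⊗ₖ L.K o i) * ρ *
      ((1 : Matrix (Fin a) (Fin a) ℂ) ⊗ₖ L.K o i)ᴴ).trace =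
      (((1 : Matrix (Fin a) (Fin a) ℂ) ⊗ₖ ((L.K o i)ᴴ * L.K o i)) * ρ).trace := fun o i => by
    rw [Matrix.trace_mul_comm, ← Matrix.mul_assoc, Matrix.conjTranspose_kronecker,
      Matrix.conjTranspose_one, ← Matrix.mul_kronecker_mul, Matrix.one_mul]
  have hs : ∑ o, ∑ i, (1 : Matrix (Fin a) (Fin a) ℂ) ⊗ₖ ((L.K o i)ᴴ * L.K o i) = 1 := by
    rw [← Matrix.one_kronecker_one, ← L.complete]
    ext p q
    simp [Matrix.sum_apply, Finset.mul_sum]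
  simp only [LocalOp.onBob, Matrix.trace_sum, h]
  simp only [← Matrix.trace_sum, ← Matrix.sum_mul, hs, Matrix.one_mul]

/-! ### Transcripts and reduction to one measurement of Alice -/

namespace Protocol

variable {x y : ℕ}

theorem finite_transcript {a b : ℕ} (P : Protocol x y a b) : Finite P.Transcript := by
  induction P with
  | done => exact inferInstanceAs (Finite Unit)
  | alice L next ih => exact inferInstanceAs (Finite (Σ o, (next o).Transcript))
  | bob L next ih => exact inferInstanceAs (Finite (Σ o, (next o).Transcript))

instance {a b : ℕ} (P : Protocol x y a b) : Fintype P.Transcript :=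
  @Fintype.ofFinite _ P.finite_transcript

theorem sum_transcript_alice {a b m : ℕ} {a' : Msg m → ℕ} {E : Type*} [AddCommMonoid E]
    (L : LocalOp m a a') (next : (o : Msg m) → Protocol x y (a' o) b)
    (f : (alice L next).Transcript → E) :
    ∑ t, f t = ∑ o, ∑ t : (next o).Transcript, f ⟨o, t⟩ := by
  rw [← Fintype.sum_sigma (α := fun o => (next o).Transcript) f]
  -- The `Fintype` instance on transcripts is obtained by choice, so it agrees with the sigma
  -- instance only propositionally.
  exact Finset.sum_congr (congrArg (@Finset.univ _) (Subsingleton.elim _ _)) fun _ _ => rfl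

theorem sum_transcript_bob {a b m : ℕ} {b' : Msg m → ℕ} {E : Type*} [AddCommMonoid E]
    (L : LocalOp m b b') (next : (o : Msg m) → Protocol x y a (b' o))
    (f : (bob L next).Transcript → E) :
    ∑ t, f t = ∑ o, ∑ t : (next o).Transcript, f ⟨o, t⟩ := by
  rw [← Fintype.sum_sigma (α := fun o => (next o).Transcript) f]
  exact Finset.sum_congr (congrArg (@Finset.univ _) (Subsingleton.elim _ _)) fun _ _ => rfl

theorem sum_transcript_done {E : Type*} [AddCommMonoid E]
    (f : (done : Protocol x y x y).Transcript → E) : ∑ t, f t = f () := by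
  rw [← Fintype.sum_unique (ι := Unit) f]
  exact Finset.sum_congr (congrArg (@Finset.univ _) (Subsingleton.elim _ _)) fun _ _ => rfl

theorem sum_le_two_pow {m : ℕ} (n k : Msg m → ℕ) (h : ∀ o, n o ≤ 2 ^ k o) :
    ∑ o, n o ≤ 2 ^ (m + Finset.univ.sup k) := by
  calc ∑ o, n o ≤ ∑ _o : Msg m, 2 ^ Finset.univ.sup k := Finset.sum_le_sum fun o _ =>
        (h o).trans (Nat.pow_le_pow_right two_pos (Finset.le_sup (Finset.mem_univ o)))
    _ = _ := by simp [pow_add]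

theorem card_transcript_le {a b : ℕ} (P : Protocol x y a b) :
    Fintype.card P.Transcript ≤ 2 ^ P.cost := by
  simp only [Fintype.card_eq_sum_ones]
  induction P with
  | done => rw [sum_transcript_done, cost, pow_zero]
  | alice L next ih => rw [sum_transcript_alice, cost]; exact sum_le_two_pow _ _ ih
  | bob L next ih => rw [sum_transcript_bob, cost]; exact sum_le_two_pow _ _ ih

theorem output_alice {a b m : ℕ} {a' : Msg m → ℕ} (L : LocalOp m a a')
    (next : (o : Msg m) → Protocol x y (a' o) b) (ρ : Matrix (Fin a × Fin b) (Fin a × Fin b) ℂ)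
    (o : Msg m) (t : (next o).Transcript) :
    (alice L next).output ρ ⟨o, t⟩ = (next o).output (L.onAlice o ρ) t := by
  rw [output]

theorem output_bob {a b m : ℕ} {b' : Msg m → ℕ} (L : LocalOp m b b')
    (next : (o : Msg m) → Protocol x y a (b' o)) (ρ : Matrix (Fin a × Fin b) (Fin a × Fin b) ℂ)
    (o : Msg m) (t : (next o).Transcript) :
    (bob L next).output ρ ⟨o, t⟩ = (next o).output (L.onBob o ρ) t := by
  rw [output]

/-- Conservation of probability; this is what later forces the completing operators to vanish on the
state. -/
theorem sum_trace_output {a b : ℕ} (P : Protocol x y a b)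
    (ρ : Matrix (Fin a × Fin b) (Fin a × Fin b) ℂ) : ∑ t, (P.output ρ t).trace = ρ.trace := by
  induction P with
  | done => rw [sum_transcript_done]; rfl
  | alice L next ih =>
    rw [sum_transcript_alice, ← L.sum_trace_onAlice ρ]
    exact Finset.sum_congr rfl fun o _ => by simp only [output_alice, ih]
  | bob L next ih =>
    rw [sum_transcript_bob, ← L.sum_trace_onBob ρ]
    exact Finset.sum_congr rfl fun o _ => by simp only [output_bob, ih]

/-- Every protocol acts on a pure state like a measurement of Alice followed by an operation of
Bob that depends on its outcome; here both are allowed to lose probability. -/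
theorem exists_submeasurement {a b r r' : ℕ} (P : Protocol x y a b)
    (Φ : Matrix (Fin a × Fin r) (Fin b × Fin r') ℂ) :
    ∃ (A B : P.Transcript → ℕ) (M : ∀ t, Matrix (Fin x × Fin (A t)) (Fin a × Fin r) ℂ)
      (V : ∀ t, Matrix (Fin y × Fin (B t)) (Fin b × Fin r') ℂ),
      IsSubmeasurement M ∧ (∀ t, IsContraction (V t)) ∧
      ∀ t, P.output (reduced Φ) t = reduced (M t * Φ * (V t)ᵀ) := by
  induction P generalizing r r' with
  | done =>
    refine ⟨fun _ => r, fun _ => r', fun _ => 1, fun _ => 1, ?_,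
      fun _ => isContraction_of_conjTranspose_mul_self (by simp), fun t => ?_⟩
    · rw [IsSubmeasurement, sum_transcript_done]
      simpa using Matrix.PosSemidef.zero
    · simp [output]
  | alice L next ih =>
    -- The induction hypothesis is used at the state after this round, whose spectator dimension has
    -- grown; hence the generalisation over `r` and `r'`.
    choose A B M V hM hV h using fun o => ih o (stack (L.K o) r * Φ)
    refine ⟨fun t => A t.1 t.2, fun t => B t.1 t.2, fun t => M t.1 t.2 * stack (L.K t.1) r,
      fun t => V t.1 t.2, ?_, fun t => hV _ _, fun t => ?_⟩
    · rw [IsSubmeasurement, sum_transcript_alice]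
      exact (L.isSubmeasurement_stack r).sigma hM
    · obtain ⟨o, t⟩ := t
      rw [output_alice, L.onAlice_reduced, h]
      simp only [Matrix.mul_assoc]
  | bob L next ih =>
    -- The exchange depends on the current state `Φ`. As `N o` is square, Alice's space is unchanged
    -- and her later operators `M` compose with it.
    obtain ⟨N, W, hN, hW, hNW⟩ := exists_swap_measurement Φ (L.isSubmeasurement_stack r')
    choose A B M V hM hV h using fun o => ih o (Φ * (stack (L.K o) r')ᵀ)
    refine ⟨fun t => A t.1 t.2, fun t => B t.1 t.2, fun t => M t.1 t.2 * N t.1,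
      fun t => V t.1 t.2 * W t.1, ?_, fun t => (hV _ _).mul (hW _), fun t => ?_⟩
    · rw [IsSubmeasurement, sum_transcript_bob]
      exact hN.sigma hM
    · obtain ⟨o, t⟩ := t
      rw [output_bob, L.onBob_reduced, h, hNW]
      simp only [Matrix.transpose_mul, Matrix.mul_assoc]

end Protocol

/-! ### Completion by operators that annihilate the state -/

theorem exists_conjTranspose_mul_self_eq {n : Type*} [Fintype n] [DecidableEq n]
    {X : Matrix n n ℂ} (h : (1 - X).PosSemidef) : ∃ D : Matrix n n ℂ, X + Dᴴ * D = 1 := by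
  open scoped MatrixOrder Matrix.Norms.L2Operator in
  obtain ⟨D, hD⟩ := CStarAlgebra.nonneg_iff_eq_star_mul_self.mp h.nonneg
  exact ⟨D, by rw [← Matrix.star_eq_conjTranspose, ← hD]; abel⟩

theorem Protocol.exists_submeasurement_pureState {x y a b : ℕ} (P : Protocol x y a b)
    (Ψ : Matrix (Fin a) (Fin b) ℂ) :
    ∃ (A B : P.Transcript → ℕ) (M : ∀ t, Matrix (Fin x × Fin (A t)) (Fin a) ℂ)
      (V : ∀ t, Matrix (Fin y × Fin (B t)) (Fin b) ℂ),
      IsSubmeasurement M ∧ (∀ t, IsContraction (V t)) ∧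
      ∀ t, P.output (pureState (coeffVec Ψ)) t = reduced (M t * Ψ * (V t)ᵀ) := by
  obtain ⟨A, B, M, V, hM, hV, h⟩ := P.exists_submeasurement
    (Ψ.submatrix (Prod.fst : Fin a × Fin 1 → Fin a) (Prod.fst : Fin b × Fin 1 → Fin b))
  refine ⟨A, B, fun t => (M t).submatrix id (Equiv.prodUnique (Fin a) (Fin 1)).symm,
    fun t => (V t).submatrix id (Equiv.prodUnique (Fin b) (Fin 1)).symm, ?_, fun t => ?_,
    fun t => ?_⟩
  · have := hM.submatrix (Equiv.prodUnique (Fin a) (Fin 1)).symm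
    unfold IsSubmeasurement
    convert this using 1
    ext i j
    simp [Matrix.sum_apply, Matrix.mul_apply, Matrix.one_apply]
  · have := (hV t).submatrix (Equiv.prodUnique (Fin b) (Fin 1)).symm
    unfold IsContraction
    convert this using 1
    ext i j
    simp [Matrix.mul_apply, Matrix.one_apply]
  · have h0 : reduced (Ψ.submatrix (Prod.fst : Fin a × Fin 1 → Fin a)
        (Prod.fst : Fin b × Fin 1 → Fin b)) = pureState (coeffVec Ψ) := by
      simp only [reduced, Finset.univ_unique, Finset.sum_singleton]
      rfl
    rw [← h0, h]
    congr 1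
    ext p q
    simp [Matrix.mul_apply, Fintype.sum_prod_type]

theorem trace_mul_transpose {m n k : Type*} [Fintype m] [Fintype n] [Fintype k]
    (X : Matrix m n ℂ) (W : Matrix k n ℂ) :
    ((X * Wᵀ)ᴴ * (X * Wᵀ)).trace = (Xᴴ * X * (Wᴴ * W)ᵀ).trace := by
  rw [Matrix.conjTranspose_mul, Matrix.mul_assoc, Matrix.trace_mul_comm, Matrix.transpose_mul]
  simp only [Matrix.mul_assoc]
  rfl

theorem trace_add_trace_eq {m n k l : Type*} [Fintype m] [Fintype n] [DecidableEq n]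
    [Fintype k] [Fintype l] (X : Matrix m n ℂ) {V : Matrix k n ℂ} {E : Matrix l n ℂ}
    (h : Vᴴ * V + Eᴴ * E = 1) :
    ((X * Vᵀ)ᴴ * (X * Vᵀ)).trace + ((X * Eᵀ)ᴴ * (X * Eᵀ)).trace = (Xᴴ * X).trace := by
  rw [trace_mul_transpose X V, trace_mul_transpose X E, ← Matrix.trace_add, ← Matrix.mul_add,
    ← Matrix.transpose_add, h, Matrix.transpose_one, Matrix.mul_one]

theorem trace_conjTranspose_mul_self_nonneg {k l : Type*} [Fintype k] [Fintype l]
    (X : Matrix k l ℂ) : 0 ≤ (Xᴴ * X).trace :=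
  (Matrix.posSemidef_conjTranspose_mul_self X).trace_nonneg

/-- If no probability is lost, the completions of a submeasurement and of contractions vanish on
the state. -/
theorem exists_completion {ι m n : Type*} {κ μ : ι → Type*} [Fintype ι] [∀ i, Fintype (κ i)]
    [∀ i, Fintype (μ i)] [Fintype m] [DecidableEq m] [Fintype n] [DecidableEq n]
    (Ψ : Matrix m n ℂ) {M : ∀ i, Matrix (κ i) m ℂ} {V : ∀ i, Matrix (μ i) n ℂ}
    (hM : IsSubmeasurement M) (hV : ∀ i, IsContraction (V i))
    (h : ∑ i, ((M i * Ψ * (V i)ᵀ)ᴴ * (M i * Ψ * (V i)ᵀ)).trace = (Ψᴴ * Ψ).trace) :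
    ∃ (D : Matrix m m ℂ) (E : ι → Matrix n n ℂ), ∑ i, (M i)ᴴ * M i + Dᴴ * D = 1 ∧
      (∀ i, (V i)ᴴ * V i + (E i)ᴴ * E i = 1) ∧ D * Ψ = 0 ∧ ∀ i, M i * Ψ * (E i)ᵀ = 0 := by
  obtain ⟨D, hD⟩ := exists_conjTranspose_mul_self_eq hM
  choose E hE using fun i => exists_conjTranspose_mul_self_eq (hV i)
  have h1 : ∑ i, ((M i * Ψ)ᴴ * (M i * Ψ)).trace + ((D * Ψ)ᴴ * (D * Ψ)).trace
      = (Ψᴴ * Ψ).trace := by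
    have : Ψᴴ * Ψ = Ψᴴ * (∑ i, (M i)ᴴ * M i + Dᴴ * D) * Ψ := by rw [hD, Matrix.mul_one]
    rw [this]
    simp only [Matrix.mul_add, Matrix.add_mul, Matrix.mul_sum, Matrix.sum_mul, Matrix.trace_add,
      Matrix.trace_sum, Matrix.conjTranspose_mul, Matrix.mul_assoc]
  have h2 := fun i => trace_add_trace_eq (M i * Ψ) (hE i)
  -- The probability lost on Bob's side plus that lost on Alice's is zero; all terms are
  -- nonnegative, so each vanishes.
  have h3 : ∑ i, ((M i * Ψ * (E i)ᵀ)ᴴ * (M i * Ψ * (E i)ᵀ)).trace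
      + ((D * Ψ)ᴴ * (D * Ψ)).trace = 0 := by
    rw [← h] at h1
    simp only [← h2, Finset.sum_add_distrib] at h1
    linear_combination h1
  have h4 := (add_eq_zero_iff_of_nonneg
    (Finset.sum_nonneg fun i _ => trace_conjTranspose_mul_self_nonneg _)
    (trace_conjTranspose_mul_self_nonneg _)).1 h3
  have h5 := (Finset.sum_eq_zero_iff_of_nonneg
    fun i _ => trace_conjTranspose_mul_self_nonneg _).1 h4.1
  exact ⟨D, E, hD, hE, Matrix.trace_conjTranspose_mul_self_eq_zero_iff.1 h4.2,
    fun i => Matrix.trace_conjTranspose_mul_self_eq_zero_iff.1 (h5 i (Finset.mem_univ i))⟩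

/-! ### Padding to isometries -/

/-- The matrix that stacks the matrices `M i`, with `i` recorded in the ancilla, and `D`, which is
placed in the slice `s₀` of the output system. -/
def pad {x : ℕ} {ι l n : Type*} {κ : ι → Type*} (s₀ : Fin x)
    (M : ∀ i, Matrix (Fin x × κ i) n ℂ) (D : Matrix l n ℂ) :
    Matrix (Fin x × ((Σ i, κ i) ⊕ l)) n ℂ :=
  Matrix.of fun p => p.2.elim (fun z => M z.1 (p.1, z.2)) fun j => if p.1 = s₀ then D j else 0

theorem pad_conjTranspose_mul_self {x : ℕ} {ι l n : Type*} {κ : ι → Type*} [Fintype ι]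
    [Fintype l] [∀ i, Fintype (κ i)] (s₀ : Fin x)
    (M : ∀ i, Matrix (Fin x × κ i) n ℂ) (D : Matrix l n ℂ) :
    (pad s₀ M D)ᴴ * pad s₀ M D = ∑ i, (M i)ᴴ * M i + Dᴴ * D := by
  ext p q
  simp only [Matrix.mul_apply, Matrix.add_apply, Matrix.sum_apply, Matrix.conjTranspose_apply,
    Fintype.sum_prod_type, Fintype.sum_sum_type, Fintype.sum_sigma, pad, Matrix.of_apply,
    Sum.elim_inl, Sum.elim_inr, Finset.sum_add_distrib]
  congr 1
  · rw [Finset.sum_comm]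
  · rw [Finset.sum_eq_single s₀ (by intro s _ hs; simp [hs]) (by simp)]
    simp

/-- Blocks meeting the slot of `D` or `E` vanish by `hD` and `hE`, and blocks with different
recorded indices by `hMV`; only the diagonal ones survive the partial trace. -/
theorem reduced_pad {x y : ℕ} {ι l l' m n : Type*} {κ μ : ι → Type*} [Fintype ι]
    [Fintype l] [Fintype l'] [Fintype m] [Fintype n] [∀ i, Fintype (κ i)]
    [∀ i, Fintype (μ i)] (s₀ : Fin x) (u₀ : Fin y) (M : ∀ i, Matrix (Fin x × κ i) m ℂ)
    (D : Matrix l m ℂ) (V : ∀ i, Matrix (Fin y × μ i) n ℂ) (E : Matrix l' n ℂ)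
    (Ψ : Matrix m n ℂ) (hD : D * Ψ = 0) (hE : ∀ i, M i * Ψ * Eᵀ = 0)
    (hMV : ∀ i j, i ≠ j → M i * Ψ * (V j)ᵀ = 0) :
    reduced (pad s₀ M D * Ψ * (pad u₀ V E)ᵀ) = ∑ i, reduced (M i * Ψ * (V i)ᵀ) := by
  classical
  have e1 : ∀ s i k u j k', (pad s₀ M D * Ψ * (pad u₀ V E)ᵀ) (s, .inl ⟨i, k⟩) (u, .inl ⟨j, k'⟩)
      = (M i * Ψ * (V j)ᵀ) (s, k) (u, k') := fun s i k u j k' => rfl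
  have e2 : ∀ s i k u j, (pad s₀ M D * Ψ * (pad u₀ V E)ᵀ) (s, .inl ⟨i, k⟩) (u, .inr j)
      = 0 := fun s i k u j => by
    have : (pad s₀ M D * Ψ * (pad u₀ V E)ᵀ) (s, .inl ⟨i, k⟩) (u, .inr j)
      = if u = u₀ then (M i * Ψ * Eᵀ) (s, k) j else 0 := by
      by_cases h : u = u₀
      · rw [Matrix.mul_apply, Matrix.mul_apply]; simp [pad, h]; rfl
      · rw [Matrix.mul_apply]; simp [pad, h]
    simp [this, hE]
  have e3 : ∀ s j q, (pad s₀ M D * Ψ * (pad u₀ V E)ᵀ) (s, .inr j) q = 0 := fun s j q => by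
    have : ∀ r, (pad s₀ M D * Ψ) (s, .inr j) r = 0 := fun r => by
      have : (pad s₀ M D * Ψ) (s, .inr j) r = if s = s₀ then (D * Ψ) j r else 0 := by
        by_cases h : s = s₀ <;> simp [Matrix.mul_apply, pad, h]
      simp [this, hD]
    simp [Matrix.mul_apply (M := pad s₀ M D * Ψ), this]
  have hp0 : pureState (0 : Fin x × Fin y → ℂ) = 0 := by simp [pureState]
  have z2 : ∀ i k j, pureState (coeffVec ((pad s₀ M D * Ψ * (pad u₀ V E)ᵀ).submatrix
      (·, .inl ⟨i, k⟩) (·, .inr j))) = 0 := fun i k j => by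
    rw [← hp0]; congr 1; ext p; exact e2 _ _ _ _ _
  have z3 : ∀ j q, pureState (coeffVec ((pad s₀ M D * Ψ * (pad u₀ V E)ᵀ).submatrix
      (·, .inr j) (·, q))) = 0 := fun j q => by
    rw [← hp0]; congr 1; ext p; exact e3 _ _ _
  have z1 : ∀ i k j k', j ≠ i → pureState (coeffVec ((pad s₀ M D * Ψ * (pad u₀ V E)ᵀ).submatrix
      (·, .inl ⟨i, k⟩) (·, .inl ⟨j, k'⟩))) = 0 := fun i k j k' hj => by
    rw [← hp0]; congr 1; ext p
    exact (e1 _ _ _ _ _ _).trans (by rw [hMV i j hj.symm]; rfl)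
  simp only [reduced, Fintype.sum_sum_type, Fintype.sum_sigma, z2, z3, Finset.sum_const_zero,
    add_zero]
  refine Finset.sum_congr rfl fun i _ => Finset.sum_congr rfl fun k _ => ?_
  rw [Finset.sum_eq_single i (fun j _ hj => Finset.sum_eq_zero fun k' _ => z1 i k j k' hj)
    (by simp)]
  rfl

/-! ### Unitary extension and the standard form -/

/-- Extension of an isometry to a unitary. -/
theorem exists_unitary_extension {m n N : Type*} [Fintype m] [DecidableEq m] [Fintype n]
    [DecidableEq n] [Fintype N] [DecidableEq N] (W : Matrix m n ℂ) (hW : Wᴴ * W = 1)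
    (f : n ↪ N) (hN : Fintype.card m = Fintype.card N) :
    ∃ U : Matrix m N ℂ, Uᴴ * U = 1 ∧ U * Uᴴ = 1 ∧ U.submatrix id f = W := by
  let v : N → EuclideanSpace ℂ m := fun j =>
    WithLp.toLp 2 fun i => if h : ∃ k, f k = j then W i h.choose else 0
  have hv : ∀ k i, v (f k) i = W i k := fun k i => by
    have h : ∃ k', f k' = f k := ⟨k, rfl⟩
    have := f.injective h.choose_spec
    simp only [v]
    rw [dif_pos h, this]
  have ho : Orthonormal ℂ ((Set.range f).domRestrict v) := by
    rw [orthonormal_iff_ite]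
    rintro ⟨_, k, rfl⟩ ⟨_, k', rfl⟩
    have := congrFun (congrFun hW k) k'
    simp only [Matrix.mul_apply, Matrix.conjTranspose_apply, Matrix.one_apply] at this
    have hif : ∀ p : Prop, ∀ [Decidable p], (p ↔ k = k') →
        (if p then (1 : ℂ) else 0) = if k = k' then 1 else 0 := fun p _ hp => by simp [hp]
    rw [hif _ (Subtype.ext_iff.trans f.injective.eq_iff), ← this]
    simp only [Set.domRestrict_apply, PiLp.inner_apply, hv, RCLike.inner_apply]
    exact Finset.sum_congr rfl fun i _ => mul_comm (W i k') (star (W i k))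
  obtain ⟨e, he⟩ := ho.exists_orthonormalBasis_extension_of_card_eq (by simpa using hN)
  have h1 : (Matrix.of fun i j => e j i : Matrix m N ℂ)ᴴ * Matrix.of (fun i j => e j i) = 1 := by
    ext j j'
    have := orthonormal_iff_ite.1 e.orthonormal j j'
    simp only [PiLp.inner_apply, RCLike.inner_apply] at this
    simp only [Matrix.mul_apply, Matrix.conjTranspose_apply, Matrix.of_apply, Matrix.one_apply,
      ← this]
    exact Finset.sum_congr rfl fun i _ => mul_comm _ _
  refine ⟨Matrix.of fun i j => e j i, h1, (Matrix.mul_eq_one_comm_of_card_eq _ _ _ hN).2 h1, ?_⟩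
  ext i k
  simp only [Matrix.submatrix_apply, Matrix.of_apply, id]
  rw [he _ ⟨k, rfl⟩, hv]

theorem mul_tensorBasis {m : Type*} {d n : ℕ} (i : Fin n) (A : Matrix m (Fin (d * n)) ℂ) :
    A * tensorBasis d i = A.submatrix id fun s => finProdFinEquiv (s, i) := by
  ext p s
  simp [Matrix.mul_apply, tensorBasis]

theorem tensorBasis_conjTranspose_mul {m : Type*} {d n : ℕ} (i : Fin n)
    (A : Matrix (Fin (d * n)) m ℂ) :
    (tensorBasis d i)ᴴ * A = A.submatrix (fun s => finProdFinEquiv (s, i)) id := by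
  ext p s
  simp [Matrix.mul_apply, tensorBasis]

theorem mul_tensorBasis_conjTranspose_transpose {m : Type*} {d n : ℕ} (i : Fin n)
    (A : Matrix m (Fin (d * n)) ℂ) :
    A * (tensorBasis d i)ᴴᵀ = A.submatrix id fun s => finProdFinEquiv (s, i) := by
  ext p s
  simp [Matrix.mul_apply, tensorBasis]

namespace StandardForm

variable {x y a b c : ℕ} (S : StandardForm x y a b c)

/-- The transcript of a protocol in standard form in which Alice sends `k`. -/
def transcript (k : Msg c) : S.toProtocol.Transcript :=
  (⟨k, default, default, default, default, ()⟩ : Σ _ : Msg c, Σ _ : Msg 0, Σ _ : Msg 0,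
    Σ _ : Msg 0, Σ _ : Msg 0, Unit)

theorem transcript_injective : Function.Injective S.transcript := fun _ _ h =>
  congrArg Sigma.fst h

theorem transcript_surjective : Function.Surjective S.transcript := by
  rintro ⟨k, o₁, o₂, o₃, o₄, ⟨⟩⟩
  refine ⟨k, ?_⟩
  rw [Subsingleton.elim o₁ default, Subsingleton.elim o₂ default, Subsingleton.elim o₃ default,
    Subsingleton.elim o₄ default]
  rfl

theorem cost_toProtocol : S.toProtocol.cost = c := by
  simp [toProtocol, Protocol.cost]

theorem output_transcript (Ψ : Matrix (Fin a) (Fin b) ℂ) (k : Msg c) :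
    S.toProtocol.output (pureState (coeffVec Ψ)) (S.transcript k) =
      reduced ((S.M k * Ψ * (S.U k * tensorBasis b S.init)ᵀ).submatrix
        finProdFinEquiv finProdFinEquiv) := by
  simp only [toProtocol, transcript, Protocol.output, LocalOp.onAlice, LocalOp.onBob,
    LocalOp.measurement, LocalOp.addAncilla, LocalOp.isometry, LocalOp.discard,
    Finset.univ_unique, Finset.sum_singleton, mul_pureState_mul, kronecker_one_mulVec,
    one_kronecker_mulVec, Matrix.mul_sum, Matrix.sum_mul, reduced]
  rw [Finset.sum_comm]
  refine Finset.sum_congr rfl fun i _ => Finset.sum_congr rfl fun j _ => ?_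
  congr 2
  rw [tensorBasis_conjTranspose_mul, mul_tensorBasis_conjTranspose_transpose,
    Matrix.transpose_mul, ← Matrix.mul_assoc]
  rfl

end StandardForm

theorem isometry_submatrix {m m' n : Type*} [Fintype m] [Fintype m'] (g : m' ≃ m)
    (A : Matrix m n ℂ) : (A.submatrix g id)ᴴ * A.submatrix g id = Aᴴ * A := by
  ext p q
  simp only [Matrix.mul_apply, Matrix.conjTranspose_apply, Matrix.submatrix_apply, id]
  exact g.sum_comp fun i => star (A i p) * A i q

/-- Bob's side of a standard form: isometries are implemented by adding an ancilla in a fixed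
state and applying a unitary. -/
theorem exists_unitary_implementation {y b : ℕ} {ι β : Type*} [Fintype β] (u₀ : Fin y)
    (s₀ : Fin b) (j₀ : β) (W : ι → Matrix (Fin y × β) (Fin b) ℂ) (hW : ∀ k, (W k)ᴴ * W k = 1) :
    ∃ (n n' : ℕ) (init : Fin n) (U : ι → Matrix (Fin (y * n')) (Fin (b * n)) ℂ),
      (∀ k, (U k)ᴴ * U k = 1) ∧ (∀ k, U k * (U k)ᴴ = 1) ∧
      ∀ {x : ℕ} {A : Type} [Fintype A] (k : ι) (Φ : Matrix (Fin x × A) (Fin b) ℂ),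
        reduced ((Φ * (U k * tensorBasis b init)ᵀ).submatrix id finProdFinEquiv) =
          reduced (Φ * (W k)ᵀ) := by
  classical
  let e := Fintype.equivFin β
  -- Sizes are chosen so that `y * n' = b * n`, as a unitary requires: the input gains a factor `y *
  -- |β|`, and the discarded output a factor `b` held in the state `s₀`.
  let n := y * Fintype.card β
  let n' := b * Fintype.card β
  let init : Fin n := finProdFinEquiv (u₀, e j₀)
  let W' : ι → Matrix (Fin y × (Fin b × β)) (Fin b) ℂ := fun k =>
    Matrix.of fun p => if p.2.1 = s₀ then W k (p.1, p.2.2) else 0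
  have hW' : ∀ k, (W' k)ᴴ * W' k = 1 := fun k => by
    rw [← hW k]
    ext p q
    simp only [Matrix.mul_apply, Matrix.conjTranspose_apply, Fintype.sum_prod_type]
    refine Finset.sum_congr rfl fun u _ => ?_
    rw [Finset.sum_eq_single s₀ (by intro s _ hs; simp [W', hs]) (by simp)]
    simp [W']
  let g : Fin b × β ≃ Fin n' := (Equiv.prodCongr (Equiv.refl _) e).trans finProdFinEquiv
  let h : Fin (y * n') ≃ Fin y × (Fin b × β) :=
    finProdFinEquiv.symm.trans (Equiv.prodCongr (Equiv.refl _) g.symm)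
  choose U hU hU' hUW using fun k => exists_unitary_extension ((W' k).submatrix h id)
    (by rw [isometry_submatrix, hW'])
    (⟨fun s => finProdFinEquiv (s, init), fun s s' hs => by simpa using hs⟩ :
      Fin b ↪ Fin (b * n)) (by simp [n, n']; ring)
  refine ⟨n, n', init, U, hU, hU', fun {x A} _ k Φ => ?_⟩
  have hUt : U k * tensorBasis b init = (W' k).submatrix h id := by
    rw [mul_tensorBasis]; exact hUW k
  simp only [hUt, reduced]
  refine Finset.sum_congr rfl fun r _ => ?_
  rw [← g.sum_comp, Fintype.sum_prod_type, Finset.sum_eq_single s₀ ?_ (by simp)]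
  · refine Finset.sum_congr rfl fun j _ => ?_
    congr 1; ext p
    simp [coeffVec, Matrix.mul_apply, W', h]
  · intro s _ hs
    refine Finset.sum_eq_zero fun j _ => ?_
    have : ∀ ψ : Fin x × Fin y → ℂ, ψ = 0 → pureState ψ = 0 := fun ψ hψ => by
      simp [hψ, pureState]
    apply this
    ext p
    simp [coeffVec, Matrix.mul_apply, W', h, hs]

theorem reduced_submatrix_left {x y : ℕ} {A A' B : Type*} [Fintype A] [Fintype A'] [Fintype B]
    (e : A' ≃ A) (Φ : Matrix (Fin x × A) (Fin y × B) ℂ) :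
    reduced (Φ.submatrix (Prod.map id e) id) = reduced Φ :=
  e.sum_comp fun r => ∑ r', pureState (coeffVec (Φ.submatrix (·, r) (·, r')))

theorem reduced_zero {x y : ℕ} {A B : Type*} [Fintype A] [Fintype B] :
    reduced (0 : Matrix (Fin x × A) (Fin y × B) ℂ) = 0 := by
  refine Finset.sum_eq_zero fun r _ => Finset.sum_eq_zero fun r' _ => ?_
  ext p q
  simp [pureState, coeffVec, Matrix.vecMulVec_apply]

theorem exists_standardForm {x y a b c : ℕ} {ι : Type} [Fintype ι] {A B : ι → ℕ}
    (e : ι ↪ Msg c) (x₀ : Fin x) (y₀ : Fin y) (b₀ : Fin b) (Ψ : Matrix (Fin a) (Fin b) ℂ)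
    {M : ∀ i, Matrix (Fin x × Fin (A i)) (Fin a) ℂ} {V : ∀ i, Matrix (Fin y × Fin (B i)) (Fin b) ℂ}
    {D : Matrix (Fin a) (Fin a) ℂ} {E : ι → Matrix (Fin b) (Fin b) ℂ}
    (hD : ∑ i, (M i)ᴴ * M i + Dᴴ * D = 1) (hE : ∀ i, (V i)ᴴ * V i + (E i)ᴴ * E i = 1)
    (hD0 : D * Ψ = 0) (hE0 : ∀ i, M i * Ψ * (E i)ᵀ = 0) :
    ∃ S : StandardForm x y a b c,
      (∀ i, S.toProtocol.output (pureState (coeffVec Ψ)) (S.transcript (e i)) =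
        reduced (M i * Ψ * (V i)ᵀ)) ∧
      ∀ k ∉ Set.range e, S.toProtocol.output (pureState (coeffVec Ψ)) (S.transcript k) = 0 := by
  classical
  let M' : Msg c → ∀ i, Matrix (Fin x × Fin (A i)) (Fin a) ℂ :=
    fun k i => if e i = k then M i else 0
  let V' : Msg c → ∀ i, Matrix (Fin y × Fin (B i)) (Fin b) ℂ :=
    fun k i => if e i = k then V i else 0
  -- Since `D * Ψ = 0`, any single outcome can carry `D`, even one that encodes a transcript.
  let D' : Msg c → Matrix (Fin a) (Fin a) ℂ := fun k => if k = default then D else 0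
  -- At messages encoding no transcript every `V' k i` is zero, so the identity alone makes Bob's
  -- operator an isometry.
  let E' : Msg c → Matrix (Fin b) (Fin b) ℂ := fun k => if h : ∃ i, e i = k then E h.choose else 1
  have hE' : ∀ i, E' (e i) = E i := fun i => by
    have h : ∃ j, e j = e i := ⟨i, rfl⟩
    simp only [E', dif_pos h, e.injective h.choose_spec]
  have hE'' : ∀ k ∉ Set.range e, E' k = 1 := fun k hk => dif_neg hk
  have hM'e : ∀ i, M' (e i) i = M i := fun i => if_pos rfl
  have hM'z : ∀ i k, e i ≠ k → M' k i = 0 := fun i k h => if_neg h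
  have hDz : ∀ k ≠ default, D' k = 0 := fun k h => if_neg h
  have hM : ∑ k, (pad x₀ (M' k) (D' k))ᴴ * pad x₀ (M' k) (D' k) = 1 := by
    simp only [pad_conjTranspose_mul_self, Finset.sum_add_distrib]
    rw [Finset.sum_comm, ← hD]
    congr 1
    · refine Finset.sum_congr rfl fun i _ => ?_
      rw [Finset.sum_eq_single (e i) (fun k _ hk => by simp [hM'z i k hk.symm]) (by simp), hM'e]
    · rw [Finset.sum_eq_single default (fun k _ hk => by simp [hDz k hk]) (by simp)]
      simp [D']
  have hV : ∀ k, (pad y₀ (V' k) (E' k))ᴴ * pad y₀ (V' k) (E' k) = 1 := fun k => by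
    rw [pad_conjTranspose_mul_self]
    by_cases hk : k ∈ Set.range e
    · obtain ⟨i, rfl⟩ := hk
      rw [hE', ← hE i, Finset.sum_eq_single i (fun j _ hj => by simp [V', hj]) (by simp)]
      simp [V']
    · rw [hE'' k hk, Finset.sum_eq_zero fun i _ => ?_]
      · simp
      · have : e i ≠ k := fun h => hk ⟨i, h⟩
        simp [V', this]
  obtain ⟨n, n', init, U, hU, hU', hUr⟩ := exists_unitary_implementation y₀ b₀ (.inr b₀)
    (fun k => pad y₀ (V' k) (E' k)) hV
  let eA := Fintype.equivFin ((Σ i, Fin (A i)) ⊕ Fin a)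
  let g : Fin (x * _) ≃ Fin x × ((Σ i, Fin (A i)) ⊕ Fin a) :=
    finProdFinEquiv.symm.trans (Equiv.prodCongr (Equiv.refl _) eA.symm)
  let S : StandardForm x y a b c :=
    { aliceAnc := Fintype.card ((Σ i, Fin (A i)) ⊕ Fin a)
      bobAnc := n'
      bobInit := n
      init := init
      M := fun k => (pad x₀ (M' k) (D' k)).submatrix g id
      M_complete := by simp only [isometry_submatrix, hM]
      U := U
      U_left := hU
      U_right := hU' }
  have hS : ∀ k, S.toProtocol.output (pureState (coeffVec Ψ)) (S.transcript k) =
      ∑ i, reduced (M' k i * Ψ * (V' k i)ᵀ) := fun k => by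
    have hd : D' k * Ψ = 0 := by
      by_cases h : k = default
      · simp [D', h, hD0]
      · rw [hDz k h, Matrix.zero_mul]
    have he : ∀ i, M' k i * Ψ * (E' k)ᵀ = 0 := fun i => by
      by_cases h : e i = k
      · rw [← h, hM'e, hE', hE0]
      · simp [hM'z i k h]
    have hmv : ∀ i j, i ≠ j → M' k i * Ψ * (V' k j)ᵀ = 0 := fun i j hij => by
      by_cases h : e i = k
      · have : e j ≠ k := fun h' => hij (e.injective (h.trans h'.symm))
        simp [V', this]
      · simp [hM'z i k h]
    rw [S.output_transcript, ← reduced_pad x₀ y₀ (M' k) (D' k) (V' k) (E' k) Ψ hd he hmv, ← hUr,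
      ← reduced_submatrix_left eA.symm]
    congr 1
    ext p q
    simp [S, g, Matrix.mul_apply]
  refine ⟨S, fun i => ?_, fun k hk => ?_⟩
  · rw [hS, Finset.sum_eq_single i (fun j _ hj => ?_) (by simp)]
    · simp [M', V']
    · rw [hM'z j _ fun h => hj (e.injective h), Matrix.zero_mul, Matrix.zero_mul, reduced_zero]
  · rw [hS]
    refine Finset.sum_eq_zero fun i _ => ?_
    rw [hM'z i k fun h => hk ⟨i, h⟩, Matrix.zero_mul, Matrix.zero_mul, reduced_zero]

end LOCC

end

/-! ### The main theorem -/

theorem claim1 {x y a b : ℕ} (ψ : Fin a × Fin b → ℂ) (hψ : ∑ p, ‖ψ p‖ ^ 2 = 1)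
    (P : LOCC.Protocol x y a b) (c : ℕ) (hP : P.cost ≤ c) :
    ∃ S : LOCC.StandardForm x y a b c,
      S.toProtocol.cost = c ∧
      ∃ enc : P.Transcript → S.toProtocol.Transcript,
        Function.Injective enc ∧
        (∀ t, S.toProtocol.output (LOCC.pureState ψ) (enc t) =
          P.output (LOCC.pureState ψ) t) ∧
        (∀ s, s ∉ Set.range enc → S.toProtocol.output (LOCC.pureState ψ) s = 0) := by
  obtain ⟨Ψ, rfl⟩ : ∃ Ψ : Matrix (Fin a) (Fin b) ℂ, ψ = LOCC.coeffVec Ψ :=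
    ⟨Matrix.of fun i j => ψ (i, j), rfl⟩
  have htr : (LOCC.pureState (LOCC.coeffVec Ψ)).trace = 1 := by
    rw [LOCC.pureState, Matrix.trace_vecMulVec, dotProduct, ← Complex.ofReal_one, ← hψ,
      Complex.ofReal_sum]
    exact Finset.sum_congr rfl fun p _ => by simp [Complex.mul_conj']
  have htr' : (LOCC.pureState (LOCC.coeffVec Ψ)).trace = (Ψᴴ * Ψ).trace := by
    rw [LOCC.pureState, Matrix.trace_vecMulVec, dotProduct, Fintype.sum_prod_type,
      Finset.sum_comm]
    simp [Matrix.trace, Matrix.mul_apply, LOCC.coeffVec, mul_comm]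
  have hout := P.sum_trace_output (LOCC.pureState (LOCC.coeffVec Ψ))
  -- Unit trace of the input, and of the total output, excludes zero dimensions; this supplies the
  -- base points needed for padding and ancillas.
  obtain ⟨p⟩ : Nonempty (Fin a × Fin b) := by
    by_contra h
    rw [not_nonempty_iff] at h
    simp [Matrix.trace] at htr
  obtain ⟨q⟩ : Nonempty (Fin x × Fin y) := by
    by_contra h
    rw [not_nonempty_iff] at h
    rw [htr, Finset.sum_eq_zero fun t _ => by simp [Matrix.trace]] at hout
    exact zero_ne_one hout
  obtain ⟨A, B, M, V, hM, hV, h⟩ := P.exists_submeasurement_pureState Ψ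
  obtain ⟨D, E, hD, hE, hD0, hE0⟩ := LOCC.exists_completion Ψ hM hV (by
    rw [← htr', ← hout]
    exact Finset.sum_congr rfl fun t _ => by rw [h, LOCC.trace_reduced])
  obtain ⟨e⟩ : Nonempty (P.Transcript ↪ LOCC.Msg c) :=
    Function.Embedding.nonempty_of_card_le <| P.card_transcript_le.trans <| by
      simpa using Nat.pow_le_pow_right two_pos hP
  obtain ⟨S, hS, hS0⟩ := LOCC.exists_standardForm e q.1 q.2 p.2 Ψ hD hE hD0 hE0
  refine ⟨S, S.cost_toProtocol, fun t => S.transcript (e t),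
    S.transcript_injective.comp e.injective, fun t => by rw [hS, h], fun s hs => ?_⟩
  obtain ⟨k, rfl⟩ := S.transcript_surjective s
  exact hS0 k fun ⟨t, ht⟩ => hs ⟨t, congrArg S.transcript ht⟩
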